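/- Let $n\ge 1$ be an integer. Write the points of the Heisenberg group $\mathbb{H}^n=\mathbb{R}^{2n}\times\mathbb{R}$ as $(x,t)=(x_1,\dots,x_{2n},t)$, equipped with Lebesgue measure, and let $$X_j=\partial_{x_j}-\tfrac{x_{n+j}}{2}\,\partial_t,\qquad X_{n+j}=\partial_{x_{n+j}}+\tfrac{x_j}{2}\,\partial_t\qquad(j=1,\dots,n)$$ be the standard left-invariant horizontal vector fields. Let $BV(\mathbb{H}^n)$ be the set of real-valued $f\in L^1(\mathbb{H}^n)$ such that, for each $j=1,\dots,2n$, the distributional derivative $X_jf$ is a signed Radon measure with finite total variation, i.e. there is a finite signed Borel measure, denoted $X_jf$, with $\int f\,X_j\varphi\,dp=-\int\varphi\,d(X_jf)$ for all $\varphi\in C_c^\infty(\mathbb{R}^{2n+1})$; let $\|X_jf\|$ denote its total variation. Then there is a constant $C>0$ depending only on $n$ such that $$\|f\|_{L^{\frac{2n+2}{2n+1}}(\mathbb{H}^n)}\le C\prod_{j=1}^{2n}\|X_jf\|^{\frac1{2n}}\qquad\text{for all } f\in BV(\mathbb{H}^n).$$ -/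

import Mathlib

open MeasureTheory
open scoped ENNReal ContDiff

/-- The underlying space `ℝ²ⁿ × ℝ` of the `n`-th Heisenberg group, with points `(x, t)`.
The `2n` horizontal coordinates are indexed by `Fin n ⊕ Fin n`: the index `Sum.inl j` stands for
`x_j` and `Sum.inr j` for `x_{n+j}`. The measure `volume` on it is Lebesgue measure. -/
abbrev Heis (n : ℕ) : Type := (Fin n ⊕ Fin n → ℝ) × ℝ

namespace Heis

variable {n : ℕ}

/-- The standard left-invariant horizontal vector fields, as vectors depending on the point:
`X_j = ∂_{x_j} - (x_{n+j} / 2) ∂_t` and `X_{n+j} = ∂_{x_{n+j}} + (x_j / 2) ∂_t`. -/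
noncomputable def horizontalField : Fin n ⊕ Fin n → Heis n → Heis n
  | Sum.inl j, p => (Pi.single (Sum.inl j) 1, -(p.1 (Sum.inr j) / 2))
  | Sum.inr j, p => (Pi.single (Sum.inr j) 1, p.1 (Sum.inl j) / 2)

/-- The classical derivative `X_j φ` of a differentiable function `φ`. -/
noncomputable def X (j : Fin n ⊕ Fin n) (φ : Heis n → ℝ) (p : Heis n) : ℝ :=
  fderiv ℝ φ p (horizontalField j p)

/-- The integral of a function with respect to a (finite) signed measure. -/
noncomputable def signedIntegral (μ : SignedMeasure (Heis n)) (φ : Heis n → ℝ) : ℝ :=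
  ∫ p, φ p ∂μ.toJordanDecomposition.posPart - ∫ p, φ p ∂μ.toJordanDecomposition.negPart

/-- The signed measure `μ` is the distributional derivative `X_j f`:
`∫ f X_j φ = - ∫ φ dμ` for all real test functions `φ ∈ C_c^∞`. (The fields `X_j` are
divergence-free, so the formal adjoint of `X_j` is `-X_j`.) -/
def IsDistribDeriv (j : Fin n ⊕ Fin n) (f : Heis n → ℝ) (μ : SignedMeasure (Heis n)) : Prop :=
  ∀ φ : Heis n → ℝ, ContDiff ℝ ∞ φ → HasCompactSupport φ →
    ∫ p, f p * X j φ p = -signedIntegral μ φ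

/-- `f ∈ BV(ℍⁿ)`: `f` is integrable and each distributional derivative `X_j f` is a finite
signed (automatically Radon) measure. -/
def MemBV (f : Heis n → ℝ) : Prop :=
  Integrable f ∧ ∀ j, ∃ μ : SignedMeasure (Heis n), IsDistribDeriv j f μ

end Heis

/-! Two ingredients combine: a Loomis-Whitney inequality for sets, and the fact that a BV function
is dominated, for each `i`, by a function of the `i`-th horizontal line.

Sets (`volume_pow_le`). The lines of `X_i` are parametrized by the slab `0 ≤ x_i < 1`, so for a
union `B i` of such lines, `volume (B i ∩ slab i)` measures how many there are. If `K` lies in every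
`B i`, deleting the points whose `i`-th line meets `K` in length below `a i` costs at most `a i *
volume (B i ∩ slab i)`. A point surviving `2n + 1` suitable deletions starts many paths whose
vertices lie in the successive refinements and whose ends lie in `K`. For each `j` the pattern `X_j,
X_{n+j}, X_j` sweeps out `x_j`, `x_{n+j}` and, through the commutator, `t`; the other fields sweep
out the other coordinates. This bounds `volume K` below (`mul_prod_le_volume`), and multiplying over
`j` makes the bound symmetric.

Functions. For a test function `χ`, `χ - χ ∘ flow i (-R)` is `X_i` of an integral of `χ` over
segments. Integrating against `f` and letting `R → ∞` shows that `|f| dp` is at most `|X_i f|`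
spread along the lines. A line-invariant density `W i ≥ |f|` follows, with integral over the slab at
most `‖X_i f‖`. Applying the set inequality to `{|f| > r}` inside `{W i > r}`, then Chebyshev and
Hölder in `r`, gives the strong-type bound (`lintegral_enorm_rpow_le`). -/

open Set Filter Topology

/-! ### Horizontal flows, lines and transversal slabs -/

namespace Heis

variable {n : ℕ}

/-- The vertical component of the `i`-th horizontal field. -/
noncomputable def slope : Fin n ⊕ Fin n → (Fin n ⊕ Fin n → ℝ) → ℝ
  | Sum.inl j, x => -(x (Sum.inr j) / 2)
  | Sum.inr j, x => x (Sum.inl j) / 2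

lemma horizontalField_eq (i : Fin n ⊕ Fin n) (p : Heis n) :
    horizontalField i p = (Pi.single i 1, slope i p.1) := by
  cases i <;> rfl

lemma contDiff_slope (i : Fin n ⊕ Fin n) : ContDiff ℝ ∞ (slope i) := by
  cases i with
  | inl j => exact ((contDiff_apply ℝ ℝ (Sum.inr j)).div_const 2).neg
  | inr j => exact (contDiff_apply ℝ ℝ (Sum.inl j)).div_const 2

lemma slope_add_single (i : Fin n ⊕ Fin n) (x : Fin n ⊕ Fin n → ℝ) (s : ℝ) :
    slope i (x + Pi.single i s) = slope i x := by
  cases i <;> simp [slope]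

/-- The flow of the `i`-th horizontal field at time `s`. -/
noncomputable def flow (i : Fin n ⊕ Fin n) (s : ℝ) (p : Heis n) : Heis n :=
  (p.1 + Pi.single i s, p.2 + s * slope i p.1)

@[simp] lemma flow_fst (i : Fin n ⊕ Fin n) (s : ℝ) (p : Heis n) :
    (flow i s p).1 = p.1 + Pi.single i s := rfl

@[simp] lemma flow_snd (i : Fin n ⊕ Fin n) (s : ℝ) (p : Heis n) :
    (flow i s p).2 = p.2 + s * slope i p.1 := rfl

lemma flow_eq (i : Fin n ⊕ Fin n) (s : ℝ) (p : Heis n) :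
    flow i s p = p + s • horizontalField i p := by
  refine Prod.ext ?_ ?_
  · simp [horizontalField_eq, ← Pi.single_smul]
  · simp [horizontalField_eq]

lemma flow_zero (i : Fin n ⊕ Fin n) (p : Heis n) : flow i 0 p = p := by
  simp [flow]

lemma flow_flow (i : Fin n ⊕ Fin n) (s r : ℝ) (p : Heis n) :
    flow i s (flow i r p) = flow i (s + r) p := by
  refine Prod.ext ?_ ?_
  · rw [flow_fst, flow_fst, flow_fst, add_assoc, ← Pi.single_add, add_comm r]
  · simp only [flow_snd, flow_fst, slope_add_single]; ring

lemma contDiff_flow (i : Fin n ⊕ Fin n) :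
    ContDiff ℝ ∞ (fun q : ℝ × Heis n => flow i q.1 q.2) := by
  have h1 : ContDiff ℝ ∞ (fun q : ℝ × Heis n => slope i q.2.1) :=
    (contDiff_slope i).comp (contDiff_fst.comp contDiff_snd)
  have h2 : ContDiff ℝ ∞ (fun s : ℝ => (Pi.single i s : Fin n ⊕ Fin n → ℝ)) :=
    (ContinuousLinearMap.single ℝ (fun _ : Fin n ⊕ Fin n => ℝ) i).contDiff
  exact ((contDiff_fst.comp contDiff_snd).add (h2.comp contDiff_fst)).prodMk
    ((contDiff_snd.comp contDiff_snd).add (contDiff_fst.mul h1))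

lemma continuous_flow (i : Fin n ⊕ Fin n) :
    Continuous (fun q : ℝ × Heis n => flow i q.1 q.2) :=
  (contDiff_flow i).continuous

lemma measurable_flow (i : Fin n ⊕ Fin n) :
    Measurable (fun q : ℝ × Heis n => flow i q.1 q.2) :=
  (continuous_flow i).measurable

lemma measurable_flow_left (i : Fin n ⊕ Fin n) (p : Heis n) : Measurable (fun s => flow i s p) :=
  (measurable_flow i).comp (measurable_id.prodMk measurable_const)

lemma measurable_flow_right (i : Fin n ⊕ Fin n) (s : ℝ) : Measurable (flow (n := n) i s) :=
  (measurable_flow i).comp (measurable_const.prodMk measurable_id)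

/-- The flow translates `x` and, over each fixed `x`, translates `t`. -/
lemma measurePreserving_flow (i : Fin n ⊕ Fin n) (s : ℝ) :
    MeasurePreserving (flow (n := n) i s) volume volume := by
  have hs : Measurable (slope (n := n) i) := (contDiff_slope i).continuous.measurable
  refine (measurePreserving_add_right (volume : Measure (Fin n ⊕ Fin n → ℝ))
    (Pi.single i s)).skew_product (g := fun x t => t + s * slope i x) ?_ ?_
  · exact measurable_snd.add ((hs.comp measurable_fst).const_mul s)
  · exact Filter.Eventually.of_forall fun x => map_add_right_eq_self volume (s * slope i x)

/-- The integral of a function along the `i`-th horizontal line through a point. -/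
noncomputable def lineIntegral (i : Fin n ⊕ Fin n) (F : Heis n → ℝ≥0∞) (p : Heis n) : ℝ≥0∞ :=
  ∫⁻ s, F (flow i s p)

lemma measurable_lineIntegral (i : Fin n ⊕ Fin n) {F : Heis n → ℝ≥0∞} (hF : Measurable F) :
    Measurable (lineIntegral i F) :=
  Measurable.lintegral_prod_left' (f := fun q : ℝ × Heis n => F (flow i q.1 q.2))
    (hF.comp (measurable_flow i))

lemma lineIntegral_flow (i : Fin n ⊕ Fin n) (F : Heis n → ℝ≥0∞) (r : ℝ) (p : Heis n) :
    lineIntegral i F (flow i r p) = lineIntegral i F p := by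
  simp only [lineIntegral, flow_flow]
  exact lintegral_add_right_eq_self (fun s => F (flow i s p)) r

lemma lineIntegral_mono (i : Fin n ⊕ Fin n) {F G : Heis n → ℝ≥0∞} (h : F ≤ G) (p : Heis n) :
    lineIntegral i F p ≤ lineIntegral i G p :=
  lintegral_mono fun _ => h _

/-- A transversal slab: it meets every `i`-th horizontal line in an interval of length one. -/
def slab (i : Fin n ⊕ Fin n) : Set (Heis n) := {p | p.1 i ∈ Ico (0 : ℝ) 1}

lemma measurable_coord (i : Fin n ⊕ Fin n) : Measurable (fun p : Heis n => p.1 i) :=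
  (measurable_pi_apply i).comp measurable_fst

lemma measurableSet_slab (i : Fin n ⊕ Fin n) : MeasurableSet (slab (n := n) i) :=
  measurable_coord i measurableSet_Ico

lemma flow_mem_slab (i : Fin n ⊕ Fin n) (s : ℝ) (p : Heis n) :
    flow i s p ∈ slab i ↔ s ∈ Ico (-p.1 i) (1 - p.1 i) := by
  simp only [slab, mem_ofPred_eq, flow_fst, Pi.add_apply, Pi.single_eq_same, mem_Ico]
  constructor <;> rintro ⟨h1, h2⟩ <;> constructor <;> linarith

lemma lineIntegral_slab (i : Fin n ⊕ Fin n) (p : Heis n) :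
    lineIntegral i ((slab i).indicator 1) p = 1 := by
  have : (fun s => (slab i).indicator (1 : Heis n → ℝ≥0∞) (flow i s p)) =
      (Ico (-p.1 i) (1 - p.1 i)).indicator 1 := by
    ext s
    by_cases h : flow i s p ∈ slab i
    · rw [indicator_of_mem h, indicator_of_mem ((flow_mem_slab i s p).1 h)]; rfl
    · rw [indicator_of_notMem h, indicator_of_notMem (fun h' => h ((flow_mem_slab i s p).2 h'))]
  rw [lineIntegral, this, lintegral_indicator_one measurableSet_Ico]
  simp

/-- Integration over the whole space is integration over the lines meeting a slab. -/
lemma setLIntegral_slab_lineIntegral (i : Fin n ⊕ Fin n) {F : Heis n → ℝ≥0∞} (hF : Measurable F) :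
    ∫⁻ p in slab i, lineIntegral i F p = ∫⁻ p, F p := by
  have hS : Measurable ((slab i).indicator (1 : Heis n → ℝ≥0∞)) :=
    measurable_one.indicator (measurableSet_slab i)
  calc ∫⁻ p in slab i, lineIntegral i F p
      = ∫⁻ p, ∫⁻ s, (slab i).indicator 1 p * F (flow i s p) := by
        rw [← lintegral_indicator (measurableSet_slab i)]
        refine lintegral_congr fun p => ?_
        have h := hF.comp (measurable_flow_left i p)
        simp only [Function.comp_def] at h
        rw [lintegral_const_mul _ h]
        by_cases h : p ∈ slab i <;> simp [h, lineIntegral]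
    _ = ∫⁻ s, ∫⁻ p, (slab i).indicator 1 p * F (flow i s p) := by
        refine lintegral_lintegral_swap (Measurable.aemeasurable ?_)
        exact (hS.comp measurable_fst).mul
          (hF.comp ((measurable_flow i).comp measurable_swap))
    -- Invariance of volume moves the flow from `F` onto the slab, whose line integral is
    -- identically 1.
    _ = ∫⁻ s, ∫⁻ p, (slab i).indicator 1 (flow i (-s) p) * F p := by
        refine lintegral_congr fun s => ?_
        have h := (measurePreserving_flow i s).lintegral_comp
          ((hS.comp (measurable_flow_right i (-s))).mul hF)
        simpa [flow_flow, flow_zero] using h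
    _ = ∫⁻ p, ∫⁻ s, (slab i).indicator 1 (flow i (-s) p) * F p := by
        refine lintegral_lintegral_swap (Measurable.aemeasurable ?_)
        exact (hS.comp ((measurable_flow i).comp
          ((measurable_fst.neg).prodMk measurable_snd))).mul (hF.comp measurable_snd)
    _ = ∫⁻ p, F p := by
        refine lintegral_congr fun p => ?_
        have h := hS.comp ((measurable_flow_left i p).comp measurable_neg)
        simp only [Function.comp_def] at h
        rw [lintegral_mul_const _ h]
        have := lintegral_neg_eq_self (μ := (volume : Measure ℝ))
          (fun s => (slab i).indicator (1 : Heis n → ℝ≥0∞) (flow i s p))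
        rw [this]
        have h1 := lineIntegral_slab i p
        rw [lineIntegral] at h1
        rw [h1, one_mul]

/-- Removing from `K` the points whose `i`-th line meets `K` in length less than `a` costs at most
`a` times the measure of the set of lines meeting `K`. -/
lemma exists_subset_le_lineIntegral (i : Fin n ⊕ Fin n) {B K : Set (Heis n)}
    (hB : MeasurableSet B) (hBi : ∀ s p, flow i s p ∈ B → p ∈ B) (hK : MeasurableSet K)
    (hKB : K ⊆ B) (a : ℝ≥0∞) :
    ∃ K' ⊆ K, MeasurableSet K' ∧ volume K ≤ volume K' + a * volume (B ∩ slab i) ∧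
      ∀ p ∈ K', a ≤ lineIntegral i (K.indicator 1) p := by
  set ℓ := lineIntegral i (K.indicator 1) with hℓ
  have hmℓ : Measurable ℓ := measurable_lineIntegral i (measurable_one.indicator hK)
  have hS : MeasurableSet {p | a ≤ ℓ p} := measurableSet_le measurable_const hmℓ
  refine ⟨K ∩ {p | a ≤ ℓ p}, inter_subset_left, hK.inter hS, ?_, fun p hp => hp.2⟩
  have hD : MeasurableSet (K \ {p | a ≤ ℓ p}) := hK.diff hS
  -- `ℓ` is constant on each line, so a line is kept or removed as a whole. A removed line carries
  -- length less than `a`, and a line outside `B` carries none.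
  have key : volume (K \ {p | a ≤ ℓ p}) ≤ a * volume (B ∩ slab i) := by
    rw [← lintegral_indicator_one hD,
      ← setLIntegral_slab_lineIntegral i (measurable_one.indicator hD)]
    calc _ ≤ ∫⁻ p in slab i, B.indicator (fun _ => a) p := by
          refine lintegral_mono fun p => ?_
          by_cases hp : p ∈ B
          · rw [indicator_of_mem hp]
            by_cases h : a ≤ ℓ p
            · have h0 : lineIntegral i ((K \ {p | a ≤ ℓ p}).indicator 1) p = 0 := by
                refine (lintegral_congr fun s => indicator_of_notMem (fun hs => hs.2 ?_) _).trans
                  lintegral_zero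
                rw [mem_ofPred_eq, hℓ, lineIntegral_flow]
                exact h
              rw [h0]
              exact zero_le
            · refine le_trans (lineIntegral_mono i ?_ p) (not_le.1 h).le
              exact indicator_le_indicator_of_subset sdiff_subset (fun _ => zero_le)
          · have h0 : lineIntegral i ((K \ {p | a ≤ ℓ p}).indicator 1) p = 0 :=
              (lintegral_congr fun s => indicator_of_notMem
                (fun hs => hp (hBi s p (hKB hs.1))) _).trans lintegral_zero
            rw [h0]
            exact zero_le
      _ = a * volume (B ∩ slab i) := by
          rw [lintegral_indicator hB, lintegral_const, Measure.restrict_restrict hB,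
            Measure.restrict_apply_univ]
  calc volume K ≤ volume (K ∩ {p | a ≤ ℓ p}) + volume (K \ {p | a ≤ ℓ p}) :=
        measure_le_inter_add_sdiff _ _ _
    _ ≤ _ := by gcongr

/-! ### Change of variables along three-step paths -/

lemma enorm_mul_lintegral_comp_sub_mul {F : ℝ → ℝ≥0∞} (hF : Measurable F) (c : ℝ) {u : ℝ}
    (hu : u ≠ 0) : ‖u‖ₑ * ∫⁻ s, F (c - u * s) = ∫⁻ t, F t := by
  have h2 : ∫⁻ t, F (c - t) = ∫⁻ t, F t := lintegral_sub_left_eq_self F c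
  have hG : Measurable (fun t => F (c - t)) := hF.comp (measurable_const.sub measurable_id)
  rw [← h2]
  nth_rewrite 2 [← Real.smul_map_volume_mul_left hu]
  rw [lintegral_smul_measure, lintegral_map hG (measurable_const_mul u), smul_eq_mul,
    Real.enorm_eq_ofReal_abs]

lemma lintegral_lintegral_sub {H : ℝ → ℝ → ℝ≥0∞} (hH : Measurable (Function.uncurry H)) :
    ∫⁻ s, ∫⁻ r, H s r = ∫⁻ s, ∫⁻ r, H (s - r) r := by
  rw [lintegral_lintegral_swap hH.aemeasurable]
  have : ∀ r, ∫⁻ s, H s r = ∫⁻ s, H (s - r) r := fun r =>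
    (lintegral_sub_right_eq_self (fun s => H s r) r).symm
  simp_rw [this]
  refine lintegral_lintegral_swap (Measurable.aemeasurable ?_)
  exact hH.comp ((measurable_snd.sub measurable_fst).prodMk measurable_fst)

/-- With the total `x_j`-displacement `s` and the `x_{n+j}`-displacement `u` fixed, `r` enters only
the height, through `-u * r`. This is the effect of the commutator of the two fields. -/
lemma flow_inl_inr_inl (j : Fin n) (s u r : ℝ) (p : Heis n) :
    flow (.inl j) r (flow (.inr j) u (flow (.inl j) (s - r) p)) =
      (p.1 + Pi.single (.inl j) s + Pi.single (.inr j) u,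
        p.2 + s * slope (.inl j) p.1 + u * (p.1 (.inl j) + s) / 2 - u * r) := by
  refine Prod.ext ?_ ?_
  · simp only [flow_fst, Pi.single_sub]
    abel
  · simp [flow, slope]
    ring

/-- The path `X_j Y_j X_j`, weighted by the time spent along `Y_j`, sweeps out the three
coordinates `x_j`, `y_j`, `t`. -/
lemma lineIntegral_inl_inr_inl (j : Fin n) {F : Heis n → ℝ≥0∞} (hF : Measurable F) (p : Heis n) :
    lineIntegral (.inl j)
      (fun q => ∫⁻ u : ℝ, ‖u‖ₑ * lineIntegral (.inl j) F (flow (.inr j) u q)) p =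
    lmarginal (fun _ => volume) {.inl j, .inr j} (fun x => ∫⁻ t, F (x, t)) p.1 := by
  have hG : Measurable (fun x => ∫⁻ t, F (x, t)) := hF.lintegral_prod_right'
  have hne : (Sum.inl j : Fin n ⊕ Fin n) ∉ ({.inr j} : Finset (Fin n ⊕ Fin n)) := by simp
  have hflow : ∀ (i : Fin n ⊕ Fin n) {α : Type} [MeasurableSpace α] {f : α → ℝ} {g : α → Heis n},
      Measurable f → Measurable g → Measurable (fun a => flow i (f a) (g a)) :=
    fun i _ _ _ _ hf hg => (measurable_flow i).comp (hf.prodMk hg)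
  rw [lmarginal_insert _ hG hne]
  simp only [lineIntegral, lmarginal_singleton]
  have m1 : Measurable (fun q : ℝ × ℝ => ‖q.2‖ₑ * ∫⁻ r,
      F (flow (.inl j) r (flow (.inr j) q.2 (flow (.inl j) q.1 p)))) := by
    refine (measurable_enorm.comp measurable_snd).mul ?_
    refine Measurable.lintegral_prod_right' (f := fun q : (ℝ × ℝ) × ℝ =>
      F (flow (.inl j) q.2 (flow (.inr j) q.1.2 (flow (.inl j) q.1.1 p)))) (hF.comp ?_)
    exact hflow _ measurable_snd (hflow _ (measurable_snd.comp measurable_fst)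
      (hflow _ (measurable_fst.comp measurable_fst) measurable_const))
  rw [lintegral_lintegral_swap m1.aemeasurable]
  have hupd : ∀ s u : ℝ, Function.update (Function.update p.1 (.inl j) (p.1 (.inl j) + s)) (.inr j)
      (p.1 (.inr j) + u) = p.1 + Pi.single (.inl j) s + Pi.single (.inr j) u := by
    intro s u
    ext k
    by_cases h1 : k = .inl j
    · subst h1; simp
    · by_cases h2 : k = .inr j
      · subst h2; simp
      · simp [h1, h2]
  calc _ = ∫⁻ u, ∫⁻ s, ∫⁻ t, F (p.1 + Pi.single (.inl j) s + Pi.single (.inr j) u, t) := by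
        refine lintegral_congr_ae ?_
        filter_upwards [compl_mem_ae_iff.2 (measure_singleton (μ := (volume : Measure ℝ)) 0)]
          with u hu
        rw [lintegral_const_mul]
        swap
        · refine Measurable.lintegral_prod_right' (f := fun q : ℝ × ℝ =>
            F (flow (.inl j) q.2 (flow (.inr j) u (flow (.inl j) q.1 p)))) (hF.comp ?_)
          exact hflow _ measurable_snd (hflow _ measurable_const
            (hflow _ measurable_fst measurable_const))
        -- Take the total displacement `s` as variable in place of the first step. For fixed `s` and
        -- `u ≠ 0`, the last step `r` then sweeps the `t`-axis with Jacobian `|u|`, which the weight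
        -- supplies.
        rw [lintegral_lintegral_sub (H := fun s r =>
          F (flow (.inl j) r (flow (.inr j) u (flow (.inl j) s p))))]
        swap
        · exact hF.comp (hflow _ measurable_snd (hflow _ measurable_const
            (hflow _ measurable_fst measurable_const)))
        rw [← lintegral_const_mul]
        swap
        · refine Measurable.lintegral_prod_right' (f := fun q : ℝ × ℝ =>
            F (flow (.inl j) q.2 (flow (.inr j) u (flow (.inl j) (q.1 - q.2) p)))) (hF.comp ?_)
          exact hflow _ measurable_snd (hflow _ measurable_const
            (hflow _ (measurable_fst.sub measurable_snd) measurable_const))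
        refine lintegral_congr fun s => ?_
        simp only [flow_inl_inr_inl]
        exact enorm_mul_lintegral_comp_sub_mul
          (F := fun t => F (p.1 + Pi.single (.inl j) s + Pi.single (.inr j) u, t))
          (hF.comp (measurable_const.prodMk measurable_id)) _ hu
    _ = ∫⁻ s, ∫⁻ u, ∫⁻ t, F (p.1 + Pi.single (.inl j) s + Pi.single (.inr j) u, t) := by
        refine lintegral_lintegral_swap (Measurable.aemeasurable ?_)
        refine hG.comp (f := fun q : ℝ × ℝ =>
          p.1 + Pi.single (.inl j) q.2 + Pi.single (.inr j) q.1) ?_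
        have h : ∀ i, Measurable (fun s : ℝ => (Pi.single i s : Fin n ⊕ Fin n → ℝ)) :=
          fun i => (continuous_single i).measurable
        exact ((h _).comp measurable_snd).const_add _ |>.add ((h _).comp measurable_fst)
    _ = _ := by
        simp_rw [← hupd]
        rw [lintegral_add_left_eq_self (fun a => ∫⁻ u, ∫⁻ t,
          F (Function.update (Function.update p.1 (.inl j) a) (.inr j) (p.1 (.inr j) + u), t))]
        refine lintegral_congr fun a => ?_
        exact lintegral_add_left_eq_self (fun b => ∫⁻ t,
          F (Function.update (Function.update p.1 (.inl j) a) (.inr j) b, t)) _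

/-- Removing the interval `(-a/4, a/4)` from `A` leaves measure at least `a/2`, on which `|u| ≥
a/4`. -/
lemma sq_div_eight_le_setLIntegral_enorm {A : Set ℝ} {a : ℝ≥0∞} (ha : a ≠ ⊤)
    (h : a ≤ volume A) : a ^ 2 / 8 ≤ ∫⁻ u in A, ‖u‖ₑ := by
  lift a to NNReal using ha
  set I := Ioo (-(a / 4 : ℝ)) (a / 4)
  have hI : volume I = ENNReal.ofReal (a / 2) := by
    rw [Real.volume_Ioo]; congr 1; ring
  have h1 : (a : ℝ≥0∞) / 2 ≤ volume (A \ I) := by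
    have h2 : (a : ℝ≥0∞) ≤ volume (A \ I) + ENNReal.ofReal (a / 2) := by
      refine h.trans ?_
      rw [← hI, add_comm]
      refine (measure_le_inter_add_sdiff _ A I).trans ?_
      gcongr
      exact inter_subset_right
    have h3 : ENNReal.ofReal (a / 2) = (a : ℝ≥0∞) / 2 := by
      rw [ENNReal.ofReal_div_of_pos two_pos]; simp
    rw [h3] at h2
    have h4 : (a : ℝ≥0∞) / 2 + a / 2 ≤ volume (A \ I) + a / 2 := by rwa [ENNReal.add_halves]
    exact (ENNReal.add_le_add_iff_right (ENNReal.div_ne_top ENNReal.coe_ne_top two_ne_zero)).1 h4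
  calc (a : ℝ≥0∞) ^ 2 / 8 = ENNReal.ofReal (a / 4) * (a / 2) := by
        have e1 : (a : ℝ≥0∞) = ENNReal.ofReal a := by simp
        have e2 : (2 : ℝ≥0∞) = ENNReal.ofReal 2 := by simp
        have e8 : (8 : ℝ≥0∞) = ENNReal.ofReal 8 := by simp
        rw [e1, e2, e8, ← ENNReal.ofReal_pow a.coe_nonneg, ← ENNReal.ofReal_div_of_pos (by norm_num),
          ← ENNReal.ofReal_div_of_pos (by norm_num), ← ENNReal.ofReal_mul (by positivity)]
        congr 1; ring
    _ ≤ ENNReal.ofReal (a / 4) * volume (A \ I) := by gcongr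
    _ = ∫⁻ u in A \ I, ENNReal.ofReal (a / 4) := by simp
    _ ≤ ∫⁻ u in A \ I, ‖u‖ₑ := by
        refine setLIntegral_mono measurable_enorm fun u hu => ?_
        rw [Real.enorm_eq_ofReal_abs]
        refine ENNReal.ofReal_le_ofReal (not_lt.1 fun hlt => hu.2 ?_)
        exact abs_lt.1 hlt
    _ ≤ _ := lintegral_mono_set sdiff_subset

/-! ### Successive refinements and the Loomis-Whitney inequality for sets -/

lemma mul_lineIntegral_indicator_le (i : Fin n ⊕ Fin n) {K : Set (Heis n)} (hK : MeasurableSet K)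
    {H : Heis n → ℝ≥0∞} {M : ℝ≥0∞} (h : ∀ p ∈ K, M ≤ H p) (p : Heis n) :
    M * lineIntegral i (K.indicator 1) p ≤ lineIntegral i H p := by
  have hm : Measurable (fun s => K.indicator (1 : Heis n → ℝ≥0∞) (flow i s p)) :=
    (measurable_one.indicator hK).comp (measurable_flow_left i p)
  rw [lineIntegral, ← lintegral_const_mul _ hm]
  refine lintegral_mono fun s => ?_
  by_cases hs : flow i s p ∈ K
  · simpa [hs] using h _ hs
  · simp [hs]

/-- Horizontal lines project to coordinate lines in `x`. Once `t` is integrated out, the remaining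
directions therefore behave as in Euclidean space. -/
lemma lineIntegral_comp_fst (i : Fin n ⊕ Fin n) (G : (Fin n ⊕ Fin n → ℝ) → ℝ≥0∞) (p : Heis n) :
    lineIntegral i (fun q => G q.1) p = ∫⁻ a, G (Function.update p.1 i a) := by
  rw [← lintegral_add_left_eq_self _ (p.1 i), lineIntegral]
  refine lintegral_congr fun s => congrArg G ?_
  ext k
  by_cases h : k = i
  · subst h; simp
  · simp [h]

/-- Lower bound for the measure of a set by products of lengths of horizontal fibres. -/
lemma mul_prod_le_volume {K : Set (Heis n)} (hK : MeasurableSet K)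
    {B : Fin n ⊕ Fin n → Set (Heis n)} (hB : ∀ i, MeasurableSet (B i))
    (hBi : ∀ i s p, flow i s p ∈ B i → p ∈ B i) (hKB : ∀ i, K ⊆ B i)
    {a : Fin n ⊕ Fin n → ℝ≥0∞} (ha : ∀ i, a i ≠ ⊤) {ε : ℝ≥0∞}
    (hε : ∀ i, a i * volume (B i ∩ slab i) ≤ ε) (hεK : (2 * n + 1) * ε < volume K) (j : Fin n) :
    a (.inl j) * a (.inr j) * ∏ i, a i ≤ 8 * volume K := by
  have step : ∀ (i : Fin n ⊕ Fin n) (L : Set (Heis n)), MeasurableSet L → L ⊆ K →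
      ∃ L' ⊆ L, MeasurableSet L' ∧ volume L ≤ volume L' + ε ∧
        ∀ p ∈ L', a i ≤ lineIntegral i (L.indicator 1) p := by
    intro i L hL hLK
    obtain ⟨L', h1, h2, h3, h4⟩ :=
      exists_subset_le_lineIntegral i (hB i) (hBi i) hL (hLK.trans (hKB i)) (a i)
    exact ⟨L', h1, h2, h3.trans (by gcongr; exact hε i), h4⟩
  obtain ⟨K1, s1, m1, v1, l1⟩ := step (.inl j) K hK subset_rfl
  obtain ⟨K2, s2, m2, v2, l2⟩ := step (.inr j) K1 m1 s1
  obtain ⟨K3, s3, m3, v3, l3⟩ := step (.inl j) K2 m2 (s2.trans s1)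
  set G : (Fin n ⊕ Fin n → ℝ) → ℝ≥0∞ := fun x => ∫⁻ t, K.indicator 1 (x, t) with hGdef
  have hF : Measurable (K.indicator (1 : Heis n → ℝ≥0∞)) := measurable_one.indicator hK
  have hG : Measurable G := hF.lintegral_prod_right'
  -- One factor `a (.inl j)` for each of the two `X_j` steps; the middle step, weighted by `|u|`,
  -- gives `a (.inr j) ^ 2 / 8`.
  set M : ℝ≥0∞ := a (.inr j) ^ 2 / 8 * a (.inl j) * a (.inl j) with hM
  set P : Finset (Fin n ⊕ Fin n) := {.inl j, .inr j} with hP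
  have base : ∀ p ∈ K3, M ≤ lmarginal (fun _ => volume) P G p.1 := by
    intro p hp
    rw [hP, hGdef, ← lineIntegral_inl_inr_inl j hF p]
    refine le_trans ?_ (mul_lineIntegral_indicator_le (.inl j) m2
      (M := a (.inr j) ^ 2 / 8 * a (.inl j)) ?_ p)
    · rw [hM]
      gcongr
      exact l3 p hp
    · intro q hq
      have mA : MeasurableSet {u | flow (.inr j) u q ∈ K1} := measurable_flow_left (.inr j) q m1
      have hA : a (.inr j) ≤ volume {u | flow (.inr j) u q ∈ K1} := by
        refine (l2 q hq).trans_eq ?_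
        rw [lineIntegral, ← lintegral_indicator_one mA]
        rfl
      calc a (.inr j) ^ 2 / 8 * a (.inl j)
          ≤ (∫⁻ u in {u | flow (.inr j) u q ∈ K1}, ‖u‖ₑ) * a (.inl j) := by
            gcongr
            exact sq_div_eight_le_setLIntegral_enorm (ha _) hA
        _ = ∫⁻ u in {u | flow (.inr j) u q ∈ K1}, ‖u‖ₑ * a (.inl j) :=
            (lintegral_mul_const _ measurable_enorm).symm
        _ ≤ ∫⁻ u in {u | flow (.inr j) u q ∈ K1},
              ‖u‖ₑ * lineIntegral (.inl j) (K.indicator 1) (flow (.inr j) u q) := by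
            refine setLIntegral_mono' mA fun u hu => ?_
            gcongr
            exact l1 _ hu
        _ ≤ _ := setLIntegral_le_lintegral _ _
  -- Each further direction costs one more refinement, hence one more `ε`, and gains a factor `a i`.
  have ind : ∀ s : Finset (Fin n ⊕ Fin n), Disjoint s P → ∃ K' ⊆ K3, MeasurableSet K' ∧
      volume K3 ≤ volume K' + s.card * ε ∧
      ∀ p ∈ K', M * ∏ i ∈ s, a i ≤ lmarginal (fun _ => volume) (s ∪ P) G p.1 := by
    intro s
    induction s using Finset.induction with
    | empty => exact fun _ => ⟨K3, subset_rfl, m3, by simp, fun p hp => by simpa using base p hp⟩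
    | insert i s hi ih =>
      intro hd
      rw [Finset.disjoint_insert_left] at hd
      obtain ⟨L, hL1, hL2, hL3, hL4⟩ := ih hd.2
      obtain ⟨L', h1, h2, h3, h4⟩ := step i L hL2 (hL1.trans (s3.trans (s2.trans s1)))
      refine ⟨L', h1.trans hL1, h2, ?_, fun p hp => ?_⟩
      · rw [Finset.card_insert_of_notMem hi]
        calc volume K3 ≤ volume L' + ε + s.card * ε := hL3.trans (by gcongr)
          _ = _ := by push_cast; ring
      · rw [Finset.insert_union, lmarginal_insert _ hG (by simp [hi, hd.1]),
          ← lineIntegral_comp_fst i _ p, Finset.prod_insert hi]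
        refine le_trans ?_ (mul_lineIntegral_indicator_le i hL2 hL4 p)
        calc M * (a i * ∏ k ∈ s, a k) = M * (∏ k ∈ s, a k) * a i := by ring
          _ ≤ _ := by gcongr; exact h4 p hp
  obtain ⟨K', hK1, hK2, hK3, hK4⟩ := ind (Finset.univ \ P) Finset.sdiff_disjoint
  have hcard : (Finset.univ \ P).card + 2 = 2 * n := by
    have h1 : P.card = 2 := Finset.card_pair (by simp)
    have h2 := Finset.card_sdiff_add_card_eq_card (Finset.subset_univ P)
    rw [h1, Finset.card_univ, Fintype.card_sum, Fintype.card_fin] at h2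
    lia
  -- There are `3 + (2n - 2) = 2n + 1` refinements, each losing at most `ε`, which by `hεK` cannot
  -- exhaust `K`.
  have hne : K'.Nonempty := by
    rw [nonempty_iff_ne_empty]
    rintro rfl
    have : volume K ≤ (2 * n + 1) * ε := by
      calc volume K ≤ (Finset.univ \ P).card * ε + ε + ε + ε := by
            refine v1.trans ?_
            gcongr
            refine v2.trans ?_
            gcongr
            refine v3.trans ?_
            gcongr
            simpa using hK3
        _ = (((Finset.univ \ P).card + 2 : ℕ) + 1) * ε := by push_cast; ring
        _ = _ := by rw [hcard]; push_cast; rfl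
    exact absurd hεK (not_lt.2 this)
  obtain ⟨p, hp⟩ := hne
  have h := hK4 p hp
  rw [Finset.sdiff_union_of_subset (Finset.subset_univ P), lmarginal_univ] at h
  have hvol : ∫⁻ x, G x ∂Measure.pi (fun _ => volume) = volume K := by
    rw [← lintegral_indicator_one hK, Measure.volume_eq_prod, lintegral_prod _ hF.aemeasurable]
    rfl
  rw [hvol] at h
  rw [← Finset.prod_sdiff (Finset.subset_univ P), hP, Finset.prod_pair (by simp)]
  calc _ = 8 * (8⁻¹ * (a (.inl j) * a (.inr j) *
        ((∏ i ∈ Finset.univ \ P, a i) * (a (.inl j) * a (.inr j))))) := by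
        rw [← mul_assoc 8, ENNReal.mul_inv_cancel (by norm_num) (by norm_num)]; ring
    _ = 8 * (M * ∏ i ∈ Finset.univ \ P, a i) := by
        rw [hM, ENNReal.div_eq_inv_mul]; ring
    _ ≤ _ := by gcongr

lemma volume_eq_zero_of_volume_inter_slab (i : Fin n ⊕ Fin n) {B : Set (Heis n)}
    (hB : MeasurableSet B) (hBi : ∀ s p, flow i s p ∈ B → p ∈ B)
    (h : volume (B ∩ slab i) = 0) : volume B = 0 := by
  rw [← lintegral_indicator_one hB,
    ← setLIntegral_slab_lineIntegral i (measurable_one.indicator hB)]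
  refine (lintegral_congr_ae ?_).trans lintegral_zero
  have h' : ∀ᵐ p ∂volume.restrict (slab i), p ∉ B := by
    rw [ae_iff]
    simpa [Measure.restrict_apply hB] using h
  filter_upwards [h'] with p hp
  exact (lintegral_congr fun s => indicator_of_notMem (fun hs => hp (hBi s p hs)) _).trans
    lintegral_zero

/-- **Loomis-Whitney inequality** for sets in the Heisenberg group. -/
theorem volume_pow_le (hn : 1 ≤ n) {K : Set (Heis n)} (hK : MeasurableSet K) (hK' : volume K ≠ ⊤)
    {B : Fin n ⊕ Fin n → Set (Heis n)} (hB : ∀ i, MeasurableSet (B i))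
    (hBi : ∀ i s p, flow i s p ∈ B i → p ∈ B i) (hKB : ∀ i, K ⊆ B i)
    (hBv : ∀ i, volume (B i ∩ slab i) ≠ ⊤) :
    volume K ^ (n * (2 * n + 1)) ≤
      (2 * n + 2) ^ (2 * n * (n + 1)) * 8 ^ n * (∏ i, volume (B i ∩ slab i)) ^ (n + 1) := by
  rcases eq_or_ne (volume K) 0 with h0 | h0
  · rw [h0, zero_pow (by positivity)]
    exact zero_le
  have hB0 : ∀ i, volume (B i ∩ slab i) ≠ 0 := fun i hi =>
    h0 (measure_mono_null (hKB i) (volume_eq_zero_of_volume_inter_slab i (hB i) (hBi i) hi))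
  have hd0 : (2 * n + 2 : ℝ≥0∞) ≠ 0 := by simp
  have hdt : (2 * n + 2 : ℝ≥0∞) ≠ ⊤ := by finiteness
  -- One part more than the `2n + 1` refinements consume, so something survives.
  set ε := volume K / (2 * n + 2) with hε
  have hεK : (2 * n + 2) * ε = volume K := ENNReal.mul_div_cancel hd0 hdt
  have hε0 : ε ≠ 0 := ENNReal.div_ne_zero.2 ⟨h0, hdt⟩
  have hεt : ε ≠ ⊤ := ENNReal.div_ne_top hK' hd0
  have hlt : (2 * n + 1) * ε < volume K := by
    rw [← hεK, show (2 * n + 2 : ℝ≥0∞) = (2 * n + 1) + 1 by ring, add_mul (2 * (n : ℝ≥0∞) + 1) 1,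
      one_mul]
    exact ENNReal.lt_add_right (ENNReal.mul_ne_top (by finiteness) hεt) hε0
  set a : Fin n ⊕ Fin n → ℝ≥0∞ := fun i => ε / volume (B i ∩ slab i) with ha
  have hav : ∀ i, a i * volume (B i ∩ slab i) = ε := fun i =>
    ENNReal.div_mul_cancel (hB0 i) (hBv i)
  have hj := mul_prod_le_volume hK hB hBi hKB (a := a) (fun i => ENNReal.div_ne_top hεt (hB0 i))
    (fun i => (hav i).le) hlt
  -- The bound for `j` doubles the exponents of the pair `j` only. In the product over all `j`,
  -- every `a i` appears `n + 1` times.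
  have hprod : (∏ i, a i) ^ (n + 1) ≤ (8 * volume K) ^ n := by
    calc (∏ i, a i) ^ (n + 1) = ∏ j : Fin n, (a (.inl j) * a (.inr j) * ∏ i, a i) := by
          rw [Finset.prod_mul_distrib, Finset.prod_mul_distrib, ← Fintype.prod_sum_type]
          simp [pow_succ, mul_comm]
      _ ≤ ∏ j : Fin n, (8 * volume K) := Finset.prod_le_prod' fun j _ => hj j
      _ = _ := by simp
  have hpow : ε ^ (2 * n) = (∏ i, a i) * ∏ i, volume (B i ∩ slab i) := by
    rw [← Finset.prod_mul_distrib, Finset.prod_congr rfl fun i _ => hav i]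
    simp [two_mul]
  have hVn : volume K ^ n ≠ 0 := pow_ne_zero _ h0
  have hVt : volume K ^ n ≠ ⊤ := ENNReal.pow_ne_top hK'
  refine (ENNReal.mul_le_mul_iff_right hVn hVt).1 ?_
  calc volume K ^ n * volume K ^ (n * (2 * n + 1))
      = (2 * n + 2) ^ (2 * n * (n + 1)) * (ε ^ (2 * n)) ^ (n + 1) := by
        rw [← pow_mul, ← mul_pow, hεK, ← pow_add]
        congr 1
        ring
    _ = (2 * n + 2) ^ (2 * n * (n + 1)) * ((∏ i, a i) ^ (n + 1) *
          (∏ i, volume (B i ∩ slab i)) ^ (n + 1)) := by rw [hpow, mul_pow]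
    _ ≤ (2 * n + 2) ^ (2 * n * (n + 1)) * ((8 * volume K) ^ n *
          (∏ i, volume (B i ∩ slab i)) ^ (n + 1)) := by gcongr
    _ = _ := by rw [mul_pow]; ring

end Heis

/-! ### From bounds on test functions to bounds on measures and densities -/

section DualBound

variable {E : Type*} [NormedAddCommGroup E] [NormedSpace ℝ E] [FiniteDimensional ℝ E]
  [MeasurableSpace E] [BorelSpace E] {μ ν : Measure E} {f : E → ℝ}

/-- Test with smooth functions into `[0, 1]` that equal 1 on `K` and are supported in thickenings
shrinking to `K`. The left side converges by dominated convergence; the right side is at most the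
`ν`-measure of the thickening. -/
lemma IsCompact.ofReal_setIntegral_le_of_forall_contDiff [IsFiniteMeasureOnCompacts ν]
    (hf : Integrable f μ)
    (h : ∀ χ : E → ℝ, ContDiff ℝ ∞ χ → HasCompactSupport χ →
      ENNReal.ofReal (∫ x, f x * χ x ∂μ) ≤ ∫⁻ x, ‖χ x‖ₑ ∂ν)
    {K : Set E} (hK : IsCompact K) : ENNReal.ofReal (∫ x in K, f x ∂μ) ≤ ν K := by
  have : ProperSpace E := FiniteDimensional.proper ℝ E
  obtain ⟨u, -, u_pos, u_lim⟩ : ∃ u : ℕ → ℝ, StrictAnti u ∧ (∀ n, u n ∈ Ioo (0 : ℝ) 1) ∧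
    Tendsto u atTop (𝓝 0) := exists_seq_strictAnti_tendsto' one_pos
  have hg : ∀ n, ∃ g : E → ℝ, Function.support g = Metric.thickening (u n) K ∧ ContDiff ℝ ∞ g ∧
      range g ⊆ Icc 0 1 ∧ ∀ x ∈ K, g x = 1 := by
    intro n
    rcases exists_contMDiff_support_eq_eq_one_iff (n := ⊤) (modelWithCornersSelf ℝ E)
      (Metric.isOpen_thickening (δ := u n)) hK.isClosed
      (Metric.self_subset_thickening (u_pos n).1 K) with ⟨g, g_smooth, g_range, g_supp, hg⟩
    exact ⟨g, g_supp, g_smooth.contDiff, g_range, fun x hx => (hg x).1 hx⟩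
  choose g g_supp g_diff g_range g_one using hg
  have g_norm : ∀ n x, ‖g n x‖ ≤ 1 := fun n x => by
    have := g_range n (mem_range_self x)
    rw [Real.norm_of_nonneg this.1]
    exact this.2
  have hK1 : IsCompact (Metric.cthickening 1 K) := hK.cthickening
  have g_comp : ∀ n, HasCompactSupport (g n) := fun n =>
    HasCompactSupport.of_support_subset_isCompact hK1 <| by
      rw [g_supp]
      exact Metric.thickening_subset_cthickening_of_le (u_pos n).2.le _
  have lim1 : Tendsto (fun n => ∫ x, f x * g n x ∂μ) atTop (𝓝 (∫ x in K, f x ∂μ)) := by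
    rw [← integral_indicator hK.measurableSet]
    refine tendsto_integral_of_dominated_convergence (fun x => ‖f x‖)
      (fun n => hf.aestronglyMeasurable.mul (g_diff n).continuous.aestronglyMeasurable) hf.norm
      (fun n => Eventually.of_forall fun x => ?_) (Eventually.of_forall fun x => ?_)
    · rw [norm_mul]
      exact mul_le_of_le_one_right (norm_nonneg _) (g_norm n x)
    · by_cases hx : x ∈ K
      · simp [g_one _ x hx, indicator_of_mem hx]
      · rw [indicator_of_notMem hx]
        refine tendsto_const_nhds.congr' ?_
        obtain ⟨ε, εpos, hε⟩ : ∃ ε, 0 < ε ∧ x ∉ Metric.thickening ε K := by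
          rw [← hK.isClosed.closure_eq, Metric.closure_eq_iInter_thickening K] at hx
          simpa using hx
        filter_upwards [(tendsto_order.1 u_lim).2 _ εpos] with n hn
        have : g n x = 0 := by
          rw [← Function.notMem_support, g_supp]
          exact fun h' => hε (Metric.thickening_mono hn.le K h')
        simp [this]
  have lim2 : Tendsto (fun n => ν (Metric.thickening (u n) K)) atTop (𝓝 (ν K)) := by
    refine (tendsto_measure_thickening_of_isClosed ⟨1, one_pos, ?_⟩ hK.isClosed).comp
      (tendsto_nhdsWithin_iff.2 ⟨u_lim, Eventually.of_forall fun n => (u_pos n).1⟩)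
    exact ((measure_mono (Metric.thickening_subset_cthickening _ _)).trans_lt
      hK1.measure_lt_top).ne
  refine le_of_tendsto_of_tendsto' (ENNReal.tendsto_ofReal lim1) lim2 fun n => ?_
  refine (h (g n) (g_diff n) (g_comp n)).trans ?_
  rw [← lintegral_indicator_one Metric.isOpen_thickening.measurableSet]
  refine lintegral_mono fun x => ?_
  by_cases hx : x ∈ Metric.thickening (u n) K
  · rw [indicator_of_mem hx, ← ofReal_norm, Pi.one_apply, ENNReal.ofReal_le_one]
    exact g_norm n x
  · rw [← g_supp, Function.notMem_support] at hx
    simp [hx]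

/-- If `∫ f χ dμ ≤ ∫ |χ| dν` for all test functions `χ`, then `|f| dμ ≤ ν`. -/
lemma withDensity_enorm_le_of_forall_contDiff [IsFiniteMeasureOnCompacts ν] (hf : Integrable f μ)
    (h : ∀ χ : E → ℝ, ContDiff ℝ ∞ χ → HasCompactSupport χ →
      ENNReal.ofReal (∫ x, f x * χ x ∂μ) ≤ ∫⁻ x, ‖χ x‖ₑ ∂ν) :
    μ.withDensity (fun x => ‖f x‖ₑ) ≤ ν := by
  wlog hfm : Measurable f generalizing f
  · obtain ⟨g, hg, hfg⟩ := hf.aemeasurable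
    have h1 : μ.withDensity (fun x => ‖f x‖ₑ) = μ.withDensity (fun x => ‖g x‖ₑ) :=
      withDensity_congr_ae (hfg.mono fun x hx => by simp only [hx])
    rw [h1]
    refine this (hf.congr hfg) (fun χ hχ hχ' => ?_) hg
    have h2 : (fun x => f x * χ x) =ᵐ[μ] fun x => g x * χ x :=
      hfg.mono fun x hx => by simp only [hx]
    rw [← integral_congr_ae h2]
    exact h χ hχ hχ'
  have key : ∀ f : E → ℝ, Integrable f μ → Measurable f →
      (∀ χ : E → ℝ, ContDiff ℝ ∞ χ → HasCompactSupport χ →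
        ENNReal.ofReal (∫ x, f x * χ x ∂μ) ≤ ∫⁻ x, ‖χ x‖ₑ ∂ν) →
      ∀ A, MeasurableSet A → (∀ x ∈ A, 0 ≤ f x) → μ.withDensity (fun x => ‖f x‖ₑ) A ≤ ν A := by
    intro f hf hfm h A hA hfA
    have : IsFiniteMeasure (μ.withDensity (fun x => ‖f x‖ₑ)) :=
      isFiniteMeasure_withDensity hf.2.ne
    rw [hA.measure_eq_iSup_isCompact]
    refine iSup_le fun K => iSup_le fun hKA => iSup_le fun hK => ?_
    refine le_trans (le_of_eq ?_) ((hK.ofReal_setIntegral_le_of_forall_contDiff hf h).trans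
      (measure_mono hKA))
    rw [withDensity_apply _ hK.measurableSet, ofReal_integral_eq_lintegral_ofReal hf.integrableOn
      (ae_restrict_of_forall_mem hK.measurableSet fun x hx => hfA x (hKA hx))]
    refine setLIntegral_congr_fun hK.measurableSet fun x hx => ?_
    rw [Real.enorm_eq_ofReal (hfA x (hKA hx))]
  refine Measure.le_iff.2 fun A hA => ?_
  have hS : MeasurableSet {x | 0 ≤ f x} := measurableSet_le measurable_const hfm
  -- Split by the sign of `f`; on the negative part the hypothesis applied to `-χ` is the hypothesis
  -- for `-f`.
  rw [← measure_inter_add_sdiff A hS, ← measure_inter_add_sdiff A hS]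
  gcongr ?_ + ?_
  · exact key f hf hfm h _ (hA.inter hS) fun x hx => hx.2
  · have h2 := key (fun x => -f x) hf.neg hfm.neg (fun χ hχ hχ' => ?_) _ (hA.diff hS)
      fun x hx => neg_nonneg.2 (not_le.1 hx.2).le
    · simpa using h2
    · simpa using h (fun x => -χ x) hχ.neg hχ'.neg

end DualBound

/-- The singular part of `ν` lives on a `μ`-null set, and discarding that set does not change the
integral of `g`. -/
lemma ae_le_rnDeriv_of_withDensity_le {α : Type*} [MeasurableSpace α] {μ ν : Measure α}
    [SigmaFinite μ] [ν.HaveLebesgueDecomposition μ] {g : α → ℝ≥0∞} (hg : AEMeasurable g μ)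
    (h : μ.withDensity g ≤ ν) : g ≤ᵐ[μ] ν.rnDeriv μ := by
  obtain ⟨S, hS, hS1, hS2⟩ := Measure.mutuallySingular_singularPart ν μ
  refine ae_le_of_forall_setLIntegral_le_of_sigmaFinite₀ hg fun A hA _ => ?_
  have hAS : MeasurableSet (A ∩ S) := hA.inter hS
  have e : (A ∩ S : Set α) =ᵐ[μ] A := by
    refine inter_ae_eq_left_of_ae_eq_univ ?_
    exact ae_eq_univ.2 hS2
  calc ∫⁻ x in A, g x ∂μ = μ.withDensity g (A ∩ S) := by
        rw [withDensity_apply _ hAS, setLIntegral_congr e]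
    _ ≤ ν (A ∩ S) := h _
    _ = ∫⁻ x in A, ν.rnDeriv μ x ∂μ := by
        conv_lhs => rw [← Measure.singularPart_add_rnDeriv ν μ]
        rw [Measure.add_apply, measure_mono_null inter_subset_right hS1, zero_add,
          withDensity_apply _ hAS, setLIntegral_congr e]

/-! ### Domination of BV functions by functions of horizontal lines -/

namespace Heis

variable {n : ℕ}

/-- The measure obtained by spreading `τ` along the `i`-th horizontal lines. -/
noncomputable def spread (i : Fin n ⊕ Fin n) (τ : Measure (Heis n)) : Measure (Heis n) :=
  (volume.prod τ).map (fun q : ℝ × Heis n => flow i q.1 q.2)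

lemma lintegral_spread (i : Fin n ⊕ Fin n) (τ : Measure (Heis n)) [SFinite τ]
    {F : Heis n → ℝ≥0∞} (hF : Measurable F) :
    ∫⁻ p, F p ∂spread i τ = ∫⁻ p, lineIntegral i F p ∂τ := by
  rw [spread, lintegral_map hF (measurable_flow i)]
  exact lintegral_prod_symm' _ (hF.comp (measurable_flow i))

lemma spread_slab (i : Fin n ⊕ Fin n) (τ : Measure (Heis n)) [SFinite τ] :
    spread i τ (slab i) = τ univ := by
  rw [← lintegral_indicator_one (measurableSet_slab i),
    lintegral_spread i τ (measurable_one.indicator (measurableSet_slab i))]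
  simp [lineIntegral_slab]

lemma spread_preimage_flow (i : Fin n ⊕ Fin n) (τ : Measure (Heis n)) [SFinite τ] (r : ℝ)
    {A : Set (Heis n)} (hA : MeasurableSet A) :
    spread i τ (flow i r ⁻¹' A) = spread i τ A := by
  have hA' := measurable_flow_right i r hA
  rw [← lintegral_indicator_one hA', ← lintegral_indicator_one hA,
    lintegral_spread i τ (measurable_one.indicator hA'),
    lintegral_spread i τ (measurable_one.indicator hA)]
  refine lintegral_congr fun p => ?_
  rw [← lineIntegral_flow i (A.indicator 1) r p]
  refine lintegral_congr fun s => ?_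
  rw [flow_flow, add_comm, ← flow_flow]
  rfl

/-- The spread measure has infinite mass when `τ ≠ 0`, but a compact set lies in a region `|x_i| ≤
R`, which meets every line in length at most `2R`. -/
instance (i : Fin n ⊕ Fin n) (τ : Measure (Heis n)) [IsFiniteMeasure τ] :
    IsFiniteMeasureOnCompacts (spread i τ) := by
  refine ⟨fun K hK => ?_⟩
  obtain ⟨R, hR⟩ := hK.bddAbove_image (f := fun p : Heis n => |p.1 i|)
    ((continuous_apply i).comp continuous_fst).abs.continuousOn
  set A : Set (Heis n) := {p | |p.1 i| ≤ R}
  have hA : MeasurableSet A := measurableSet_le (measurable_coord i).abs measurable_const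
  have hKA : K ⊆ A := fun p hp => hR (mem_image_of_mem _ hp)
  refine (measure_mono hKA).trans_lt ?_
  rw [← lintegral_indicator_one hA, lintegral_spread i τ (measurable_one.indicator hA)]
  have : ∀ p, lineIntegral i (A.indicator 1) p ≤ ENNReal.ofReal (2 * R) := by
    intro p
    have h1 : (fun s => A.indicator (1 : Heis n → ℝ≥0∞) (flow i s p)) =
        (Icc (-R - p.1 i) (R - p.1 i)).indicator 1 := by
      ext s
      have : flow i s p ∈ A ↔ s ∈ Icc (-R - p.1 i) (R - p.1 i) := by
        simp only [A, mem_ofPred_eq, flow_fst, Pi.add_apply, Pi.single_eq_same, abs_le, mem_Icc]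
        constructor <;> rintro ⟨h1, h2⟩ <;> constructor <;> linarith
      by_cases h : flow i s p ∈ A
      · rw [indicator_of_mem h, indicator_of_mem (this.1 h)]; rfl
      · rw [indicator_of_notMem h, indicator_of_notMem (fun h' => h (this.2 h'))]
    rw [lineIntegral, h1, lintegral_indicator_one measurableSet_Icc, Real.volume_Icc]
    exact ENNReal.ofReal_le_ofReal (by linarith)
  refine (lintegral_mono this).trans_lt ?_
  rw [lintegral_const]
  exact ENNReal.mul_lt_top ENNReal.ofReal_lt_top (measure_lt_top _ _)

/-- An integrable function dominated in the dual sense by an invariant measure is dominated almost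
everywhere by a function that is constant on horizontal lines. -/
lemma exists_invariant_bound (i : Fin n ⊕ Fin n) (τ : Measure (Heis n)) [IsFiniteMeasure τ]
    {f : Heis n → ℝ} (hf : Measurable f)
    (h : volume.withDensity (fun p => ‖f p‖ₑ) ≤ spread i τ) :
    ∃ W : Heis n → ℝ≥0∞, Measurable W ∧ (∀ s p, W (flow i s p) = W p) ∧
      (∀ᵐ p, ‖f p‖ₑ ≤ W p) ∧ ∫⁻ p in slab i, W p ≤ τ univ := by
  set w := (spread i τ).rnDeriv volume with hw
  have hwm : Measurable w := Measure.measurable_rnDeriv _ _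
  have hS := measurableSet_slab (n := n) i
  have hm : Measurable ((slab i).indicator w) := hwm.indicator hS
  refine ⟨lineIntegral i ((slab i).indicator w), measurable_lineIntegral i hm,
    fun s p => lineIntegral_flow i _ s p, ?_, ?_⟩
  -- Spread measures and volume are both invariant under the flow, so every translate of `f` along
  -- the flow satisfies the same domination.
  · have h1 : ∀ r, ∀ᵐ p, ‖f (flow i (-r) p)‖ₑ ≤ w p := by
      intro r
      refine ae_le_rnDeriv_of_withDensity_le
        (hf.comp (measurable_flow_right i (-r))).enorm.aemeasurable
        (Measure.le_iff.2 fun A hA => ?_)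
      have hA' := measurable_flow_right i r hA
      rw [withDensity_apply _ hA, ← spread_preimage_flow i τ r hA]
      refine le_trans (le_of_eq ?_) (h _)
      have h0 := (measurePreserving_flow i r).setLIntegral_comp_preimage hA
        (hf.comp (measurable_flow_right i (-r))).enorm
      rw [withDensity_apply _ hA']
      simpa [flow_flow, flow_zero] using h0.symm
    have h2 : ∀ r, ∀ᵐ p, ‖f p‖ₑ ≤ w (flow i r p) := by
      intro r
      filter_upwards [(measurePreserving_flow i r).quasiMeasurePreserving.ae (h1 r)] with p hp
      simpa [flow_flow, flow_zero] using hp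
    have h3 : ∀ᵐ p : Heis n, ∀ᵐ r : ℝ, ‖f p‖ₑ ≤ w (flow i r p) := by
      refine (Measure.ae_ae_comm ?_).2 (Eventually.of_forall h2)
      exact measurableSet_le (hf.comp measurable_fst).enorm
        (hwm.comp ((measurable_flow i).comp measurable_swap))
    -- The density `w` need not be exactly invariant. Averaging over the unit-length part of the
    -- line in the slab yields a bound invariant at every point.
    filter_upwards [h3] with p hp
    calc ‖f p‖ₑ = ‖f p‖ₑ * lineIntegral i ((slab i).indicator 1) p := by
          rw [lineIntegral_slab, mul_one]
      _ = ∫⁻ s, ‖f p‖ₑ * (slab i).indicator 1 (flow i s p) := by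
          have h4 := (measurable_one.indicator hS : Measurable
            ((slab i).indicator (1 : Heis n → ℝ≥0∞))).comp (measurable_flow_left i p)
          rw [lintegral_const_mul _ (by simpa [Function.comp_def] using h4)]
          rfl
      _ ≤ _ := by
          refine lintegral_mono_ae ?_
          filter_upwards [hp] with s hs
          by_cases hsl : flow i s p ∈ slab i <;> simp [hsl, hs]
  · rw [setLIntegral_slab_lineIntegral i hm, lintegral_indicator hS, ← spread_slab i τ]
    exact Measure.setLIntegral_rnDeriv_le _

/-- The integral of a test function over a horizontal segment of length `R`. -/
noncomputable def segmentIntegral (i : Fin n ⊕ Fin n) (χ : Heis n → ℝ) (R : ℝ) (p : Heis n) : ℝ :=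
  ∫ r in (0 : ℝ)..R, χ (flow i (-r) p)

lemma contDiff_segmentIntegral (i : Fin n ⊕ Fin n) {χ : Heis n → ℝ} (hχ : ContDiff ℝ ∞ χ)
    {R : ℝ} (hR : 0 < R) : ContDiff ℝ ∞ (segmentIntegral i χ R) := by
  -- The cutoff is 1 wherever the segment is integrated, and makes the integrand compactly supported
  -- in the flow time uniformly in `p`, so smoothness of parametric convolutions applies.
  let b : ContDiffBump (0 : ℝ) := ⟨R, R + 1, hR, by linarith⟩
  have hb : ∀ r ∈ Ioc 0 R, b (-r) = 1 := fun r hr => b.one_of_mem_closedBall (by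
    simp [b, abs_of_pos hr.1, hr.2])
  have e : segmentIntegral i χ R = fun p => convolution ((Ioc 0 R).indicator (1 : ℝ → ℝ))
      (fun y => b y * χ (flow i y p)) (ContinuousLinearMap.mul ℝ ℝ) volume 0 := by
    ext p
    rw [convolution_def, segmentIntegral, intervalIntegral.integral_of_le hR.le,
      ← integral_indicator measurableSet_Ioc]
    refine integral_congr_ae (Eventually.of_forall fun r => ?_)
    by_cases hr : r ∈ Ioc 0 R
    · simp [hr, hb r hr]
    · simp [hr]
  rw [e, ← contDiffOn_univ]
  refine contDiffOn_convolution_right_with_param_comp (n := ⊤)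
    (g := fun p y => b y * χ (flow i y p)) (v := fun _ => (0 : ℝ)) _
    contDiffOn_const isOpen_univ b.hasCompactSupport.isCompact ?_ ?_ ?_
  · intro p y _ hy
    simp [image_eq_zero_of_notMem_tsupport hy]
  · exact ((integrable_indicator_iff measurableSet_Ioc).2
      (integrableOn_const (by simp))).locallyIntegrable
  · refine ContDiff.contDiffOn ?_
    exact (b.contDiff.comp contDiff_snd).mul
      (hχ.comp ((contDiff_flow i).comp (contDiff_snd.prodMk contDiff_fst)))

lemma hasCompactSupport_segmentIntegral (i : Fin n ⊕ Fin n) {χ : Heis n → ℝ}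
    (hχ : HasCompactSupport χ) {R : ℝ} (hR : 0 < R) :
    HasCompactSupport (segmentIntegral i χ R) := by
  have hK : IsCompact ((fun q : ℝ × Heis n => flow i q.1 q.2) '' (Icc 0 R ×ˢ tsupport χ)) :=
    (isCompact_Icc.prod hχ.isCompact).image (continuous_flow i)
  refine HasCompactSupport.intro hK fun p hp => ?_
  rw [segmentIntegral, intervalIntegral.integral_congr (g := fun _ => 0)]
  · simp
  · intro r hr
    rw [uIcc_of_le hR.le] at hr
    by_contra hne
    refine hp ⟨(r, flow i (-r) p), ⟨hr, subset_tsupport _ hne⟩, ?_⟩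
    simp [flow_flow, flow_zero]

/-- At `flow i s p` the segment integral is the integral of `r ↦ χ (flow i r p)` from `s - R` to
`s`; differentiate both endpoints at `s = 0`. -/
lemma X_segmentIntegral (i : Fin n ⊕ Fin n) {χ : Heis n → ℝ} (hχ : ContDiff ℝ ∞ χ)
    {R : ℝ} (hR : 0 < R) (p : Heis n) :
    X i (segmentIntegral i χ R) p = χ p - χ (flow i (-R) p) := by
  have hc : Continuous (fun r => χ (flow i r p)) :=
    hχ.continuous.comp ((continuous_flow i).comp (continuous_id.prodMk continuous_const))
  have h1 : HasDerivAt (fun s => segmentIntegral i χ R (flow i s p))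
      (X i (segmentIntegral i χ R) p) 0 := by
    have hd : HasFDerivAt (segmentIntegral i χ R) (fderiv ℝ (segmentIntegral i χ R) p)
        (flow i 0 p) := by
      rw [flow_zero]
      exact ((contDiff_segmentIntegral i hχ hR).differentiable (by simp)).differentiableAt.hasFDerivAt
    have hl : HasDerivAt (fun s : ℝ => flow i s p) (horizontalField i p) 0 := by
      have : (fun s : ℝ => flow i s p) = fun s => p + s • horizontalField i p :=
        funext fun s => flow_eq i s p
      rw [this]
      simpa using ((hasDerivAt_id (0 : ℝ)).smul_const (horizontalField i p)).const_add p
    exact hd.comp_hasDerivAt 0 hl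
  have h2 : (fun s => segmentIntegral i χ R (flow i s p)) =
      fun s => (∫ r in (0 : ℝ)..s, χ (flow i r p)) - ∫ r in (0 : ℝ)..(s - R), χ (flow i r p) := by
    ext s
    rw [intervalIntegral.integral_interval_sub_left (hc.intervalIntegrable _ _)
      (hc.intervalIntegrable _ _), segmentIntegral]
    have := intervalIntegral.integral_comp_sub_left (a := 0) (b := R)
      (fun r => χ (flow i r p)) s
    rw [sub_zero] at this
    rw [← this]
    refine intervalIntegral.integral_congr fun r _ => ?_
    simp only [flow_flow]
    rw [show -r + s = s - r by ring]
  have h3 : HasDerivAt (fun s => segmentIntegral i χ R (flow i s p))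
      (χ p - χ (flow i (-R) p)) 0 := by
    rw [h2]
    have key : ∀ x, HasDerivAt (fun s => ∫ r in (0 : ℝ)..s, χ (flow i r p)) (χ (flow i x p)) x :=
      fun x => intervalIntegral.integral_hasDerivAt_right (hc.intervalIntegrable _ _)
        (hc.stronglyMeasurableAtFilter _ _) hc.continuousAt
    have k0 := key 0
    rw [flow_zero] at k0
    refine k0.sub ?_
    have k1 : HasDerivAt (fun s : ℝ => s - R) 1 0 := (hasDerivAt_id 0).sub_const R
    have k2 := key (-R)
    rw [show -R = (0 : ℝ) - R by ring] at k2
    have k3 := k2.comp (0 : ℝ) k1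
    rw [zero_sub, mul_one] at k3
    exact k3
  exact h1.unique h3

lemma enorm_segmentIntegral_le (i : Fin n ⊕ Fin n) (χ : Heis n → ℝ) {R : ℝ} (hR : 0 < R)
    (p : Heis n) : ‖segmentIntegral i χ R p‖ₑ ≤ lineIntegral i (fun q => ‖χ q‖ₑ) p := by
  rw [segmentIntegral, intervalIntegral.integral_of_le hR.le]
  refine (enorm_integral_le_lintegral_enorm _).trans ((setLIntegral_le_lintegral _ _).trans_eq ?_)
  exact lintegral_neg_eq_self (μ := (volume : Measure ℝ)) (fun r => ‖χ (flow i r p)‖ₑ)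

lemma ofReal_neg_signedIntegral_le (μ : SignedMeasure (Heis n)) (φ : Heis n → ℝ) :
    ENNReal.ofReal (-signedIntegral μ φ) ≤ ∫⁻ p, ‖φ p‖ₑ ∂μ.totalVariation := by
  rw [SignedMeasure.totalVariation, lintegral_add_measure]
  calc ENNReal.ofReal (-signedIntegral μ φ) ≤ ‖signedIntegral μ φ‖ₑ := by
        rw [Real.enorm_eq_ofReal_abs]
        exact ENNReal.ofReal_le_ofReal (neg_le_abs _)
    _ ≤ _ := enorm_sub_le
    _ ≤ _ := add_le_add (enorm_integral_le_lintegral_enorm _) (enorm_integral_le_lintegral_enorm _)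

lemma eventually_flow_neg_eq_zero (i : Fin n ⊕ Fin n) {χ : Heis n → ℝ}
    (hχ : HasCompactSupport χ) (p : Heis n) :
    ∀ᶠ R in atTop, χ (flow i (-R) p) = 0 := by
  obtain ⟨M, hM⟩ := hχ.isCompact.bddBelow_image (f := fun p : Heis n => p.1 i)
    ((continuous_apply i).comp continuous_fst).continuousOn
  filter_upwards [eventually_gt_atTop (p.1 i - M)] with R hR
  refine image_eq_zero_of_notMem_tsupport fun hmem => ?_
  have := hM (mem_image_of_mem _ hmem)
  simp at this
  linarith

/-- Test the distributional derivative with `segmentIntegral i χ R`, which is bounded by the full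
line integral of `|χ|` uniformly in `R`. The error `∫ f · χ ∘ flow i (-R)` vanishes as `R → ∞`,
since every line leaves the support of `χ`. -/
lemma IsDistribDeriv.ofReal_integral_le {i : Fin n ⊕ Fin n} {f : Heis n → ℝ}
    {μ : SignedMeasure (Heis n)} (h : IsDistribDeriv i f μ) (hf : Integrable f)
    {χ : Heis n → ℝ} (hχ : ContDiff ℝ ∞ χ) (hχ' : HasCompactSupport χ) :
    ENNReal.ofReal (∫ p, f p * χ p) ≤ ∫⁻ p, ‖χ p‖ₑ ∂spread i μ.totalVariation := by
  obtain ⟨C, hC⟩ := hχ'.exists_bound_of_continuous hχ.continuous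
  have hcf : ∀ R, Continuous (fun p => χ (flow i (-R) p)) := fun R =>
    hχ.continuous.comp ((continuous_flow i).comp (continuous_const.prodMk continuous_id))
  have hlim : Tendsto (fun R => ∫ p, f p * χ (flow i (-R) p)) atTop (𝓝 0) := by
    rw [← integral_zero (Heis n) ℝ (μ := volume)]
    refine tendsto_integral_filter_of_dominated_convergence (fun p => ‖f p‖ * C)
      (Eventually.of_forall fun R => hf.aestronglyMeasurable.mul (hcf R).aestronglyMeasurable)
      (Eventually.of_forall fun R => Eventually.of_forall fun p => ?_) (hf.norm.mul_const C)
      (Eventually.of_forall fun p => ?_)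
    · rw [norm_mul]
      gcongr
      exact hC _
    · refine tendsto_const_nhds.congr' ?_
      filter_upwards [eventually_flow_neg_eq_zero i hχ' p] with R hR
      simp [hR]
  have hlim' := (ENNReal.tendsto_ofReal hlim).add_const
    (∫⁻ p, ‖χ p‖ₑ ∂spread i μ.totalVariation)
  rw [ENNReal.ofReal_zero, zero_add] at hlim'
  refine ge_of_tendsto hlim' ?_
  filter_upwards [eventually_gt_atTop 0] with R hR
  have hint : ∀ {g : Heis n → ℝ}, Continuous g → (∀ p, ‖g p‖ ≤ C) →
      Integrable (fun p => f p * g p) := fun hg hgC =>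
    hf.mul_bdd (c := C) hg.aestronglyMeasurable (Eventually.of_forall hgC)
  have hR' := h _ (contDiff_segmentIntegral i hχ hR) (hasCompactSupport_segmentIntegral i hχ' hR)
  simp only [X_segmentIntegral i hχ hR, mul_sub] at hR'
  rw [integral_sub (hint hχ.continuous hC) (hint (hcf R) fun p => hC _), sub_eq_iff_eq_add'] at hR'
  rw [hR']
  refine ENNReal.ofReal_add_le.trans ?_
  gcongr
  refine (ofReal_neg_signedIntegral_le μ _).trans ?_
  rw [lintegral_spread i _ hχ.continuous.measurable.enorm]
  exact lintegral_mono fun p => enorm_segmentIntegral_le i χ hR p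

instance (μ : SignedMeasure (Heis n)) : IsFiniteMeasure μ.totalVariation := by
  rw [SignedMeasure.totalVariation]
  infer_instance

/-- A function of bounded variation is dominated by a function constant on `i`-th horizontal lines
whose integral over the space of lines is at most the total variation of `X_i f`. -/
lemma IsDistribDeriv.exists_invariant_bound {i : Fin n ⊕ Fin n} {f : Heis n → ℝ}
    {μ : SignedMeasure (Heis n)} (h : IsDistribDeriv i f μ) (hf : Integrable f)
    (hfm : Measurable f) :
    ∃ W : Heis n → ℝ≥0∞, Measurable W ∧ (∀ s p, W (flow i s p) = W p) ∧
      (∀ᵐ p, ‖f p‖ₑ ≤ W p) ∧ ∫⁻ p in slab i, W p ≤ μ.totalVariation univ :=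
  Heis.exists_invariant_bound i _ hfm
    (withDensity_enorm_le_of_forall_contDiff hf fun _ => h.ofReal_integral_le hf)

end Heis

/-! ### Layer cake and the functional inequality -/

lemma ENNReal.volume_setOf_pos_ofReal_lt (w : ℝ≥0∞) :
    volume {r : ℝ | 0 < r ∧ ENNReal.ofReal r < w} = w := by
  rcases eq_or_ne w ⊤ with rfl | hw
  · have : {r : ℝ | 0 < r ∧ ENNReal.ofReal r < ⊤} = Ioi 0 := by
      ext r; simp
    rw [this, Real.volume_Ioi]
  · have : {r : ℝ | 0 < r ∧ ENNReal.ofReal r < w} = Ioo 0 w.toReal := by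
      ext r
      refine and_congr_right fun hr => ?_
      rw [ENNReal.ofReal_lt_iff_lt_toReal hr.le hw]
    rw [this, Real.volume_Ioo, sub_zero, ENNReal.ofReal_toReal hw]

/-- The layer cake formula for functions with values in `[0, ∞]`. -/
lemma MeasureTheory.lintegral_measure_ofReal_lt {α : Type*} [MeasurableSpace α] {μ : Measure α}
    [SFinite μ] {W : α → ℝ≥0∞} (hW : Measurable W) :
    ∫⁻ r in Ioi (0 : ℝ), μ {x | ENNReal.ofReal r < W x} = ∫⁻ x, W x ∂μ := by
  set S : Set (ℝ × α) := {q | 0 < q.1 ∧ ENNReal.ofReal q.1 < W q.2} with hS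
  have mS : MeasurableSet S := (measurableSet_lt measurable_const measurable_fst).inter
    (measurableSet_lt measurable_fst.ennreal_ofReal (hW.comp measurable_snd))
  calc _ = ∫⁻ r : ℝ, μ (Prod.mk r ⁻¹' S) := by
        rw [← lintegral_indicator measurableSet_Ioi]
        refine lintegral_congr fun r => ?_
        by_cases hr : 0 < r
        · rw [indicator_of_mem (mem_Ioi.2 hr)]
          simp [hS, hr]
        · rw [indicator_of_notMem (by simpa using hr)]
          simp [hS, hr]
    _ = ∫⁻ x, volume ((fun r => (r, x)) ⁻¹' S) ∂μ := by
        rw [← Measure.prod_apply mS, Measure.prod_apply_symm mS]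
    _ = _ := lintegral_congr fun x => ENNReal.volume_setOf_pos_ofReal_lt (W x)

namespace Heis

variable {n : ℕ}

/-- A functional form of the Loomis-Whitney inequality: a function dominated, for every `i`, by a
function `W i` of the `i`-th horizontal line. -/
lemma lintegral_enorm_rpow_le (hn : 1 ≤ n) {f : Heis n → ℝ} (hf : Measurable f)
    (hfi : Integrable f) {W : Fin n ⊕ Fin n → Heis n → ℝ≥0∞} (hW : ∀ i, Measurable (W i))
    (hWi : ∀ i s p, W i (flow i s p) = W i p) (hfW : ∀ i, ∀ᵐ p, ‖f p‖ₑ ≤ W i p)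
    {T : Fin n ⊕ Fin n → ℝ≥0∞} (hT : ∀ i, T i ≠ ⊤) (hWT : ∀ i, ∫⁻ p in slab i, W i p ≤ T i)
    {q : ℝ} (hq : q = (2 * n + 2) / (2 * n + 1)) :
    ∫⁻ p, ‖f p‖ₑ ^ q ≤ ENNReal.ofReal q *
      (((2 * n + 2) ^ (2 * n * (n + 1)) * 8 ^ n) ^ (1 / (n * (2 * n + 1)) : ℝ) *
        (∏ i, T i) ^ (q / (2 * n))) := by
  have hn0 : (0 : ℝ) < n := by exact_mod_cast hn
  have hq1 : 1 < q := by rw [hq, one_lt_div (by positivity)]; linarith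
  have hq0 : 0 < q := by linarith
  set c : ℝ≥0∞ := ((2 * n + 2) ^ (2 * n * (n + 1)) * 8 ^ n) ^ (1 / (n * (2 * n + 1)) : ℝ) with hc
  have hct : c ≠ ⊤ := ENNReal.rpow_ne_top_of_nonneg (by positivity) (by finiteness)
  set v : Fin n ⊕ Fin n → ℝ → ℝ≥0∞ :=
    fun i r => volume.restrict (slab i) {p | ENNReal.ofReal r < W i p} with hv
  have hvm : ∀ i, Measurable (v i) := fun i => by
    have : Antitone (v i) := fun r s hrs => measure_mono fun p hp =>
      (ENNReal.ofReal_le_ofReal hrs).trans_lt hp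
    exact this.measurable
  have hmeasW : ∀ i r, MeasurableSet {p | ENNReal.ofReal r < W i p} := fun i r =>
    measurableSet_lt measurable_const (hW i)
  -- Chebyshev on the space of lines.
  have hvT : ∀ i r, ENNReal.ofReal r * v i r ≤ T i := fun i r => by
    refine le_trans ?_ (hWT i)
    refine le_trans ?_ (mul_meas_ge_le_lintegral (hW i) (ENNReal.ofReal r))
    have : v i r ≤ volume.restrict (slab i) {p | ENNReal.ofReal r ≤ W i p} :=
      measure_mono fun p (hp : ENNReal.ofReal r < W i p) => hp.le
    gcongr
  have hvint : ∀ i, ∫⁻ r in Ioi (0 : ℝ), v i r ≤ T i := fun i =>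
    (lintegral_measure_ofReal_lt (hW i)).trans_le (hWT i)
  have hvol : ∀ r : ℝ, 0 < r → volume {p | r < ‖f p‖} ≤ c * (∏ i, v i r) ^ (q / (2 * n)) := by
    intro r hr
    have hr0 : ENNReal.ofReal r ≠ 0 := by simpa using hr
    -- Domination by `W i` holds only almost everywhere; the intersection gives a genuine inclusion
    -- without changing the measure.
    set K : Set (Heis n) := {p | r < ‖f p‖} ∩ ⋂ i, {p | ENNReal.ofReal r < W i p} with hKdef
    have hK : MeasurableSet K := (measurableSet_lt measurable_const hf.norm).inter
      (MeasurableSet.iInter fun i => hmeasW i r)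
    have hKae : volume {p | r < ‖f p‖} = volume K := by
      refine measure_congr ?_
      filter_upwards [ae_all_iff.2 hfW] with p hp
      refine propext ⟨fun h => ⟨h, mem_iInter.2 fun i => lt_of_lt_of_le ?_ (hp i)⟩, fun h => h.1⟩
      rw [← ofReal_norm]
      exact (ENNReal.ofReal_lt_ofReal_iff (hr.trans h)).2 h
    have hKt : volume K ≠ ⊤ := by
      rw [← hKae]
      have h1 := mul_meas_ge_le_lintegral (μ := volume) hf.enorm (ENNReal.ofReal r)
      have h2 : volume {p | ENNReal.ofReal r ≤ ‖f p‖ₑ} < ⊤ := by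
        refine lt_top_iff_ne_top.2 fun htop => ?_
        rw [htop, ENNReal.mul_top hr0] at h1
        exact absurd hfi.2 (not_lt.2 h1)
      refine ((measure_mono fun p hp => ?_).trans_lt h2).ne
      rw [mem_ofPred_eq, ← ofReal_norm]
      exact ENNReal.ofReal_le_ofReal (le_of_lt hp)
    have hvr : ∀ i, volume ({p | ENNReal.ofReal r < W i p} ∩ slab i) = v i r := fun i =>
      (Measure.restrict_apply (hmeasW i r)).symm
    have hLW := volume_pow_le hn hK hKt (B := fun i => {p | ENNReal.ofReal r < W i p})
      (fun i => hmeasW i r) (fun i s p hp => by simpa [hWi] using hp)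
      (fun i p hp => mem_iInter.1 hp.2 i) (fun i => by
        rw [hvr]
        intro htop
        have := hvT i r
        rw [htop, ENNReal.mul_top hr0, top_le_iff] at this
        exact hT i this)
    simp only [hvr] at hLW
    have hN : (0 : ℝ) < n * (2 * n + 1) := by positivity
    rw [hKae]
    calc volume K = (volume K ^ (n * (2 * n + 1))) ^ (1 / (n * (2 * n + 1)) : ℝ) := by
          rw [← ENNReal.rpow_natCast, ← ENNReal.rpow_mul]
          push_cast
          rw [mul_one_div_cancel hN.ne', ENNReal.rpow_one]
      _ ≤ _ := ENNReal.rpow_le_rpow hLW (by positivity)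
      _ = c * (∏ i, v i r) ^ (q / (2 * n)) := by
          rw [ENNReal.mul_rpow_of_nonneg _ _ (by positivity), ← ENNReal.rpow_natCast (∏ i, v i r),
            ← ENNReal.rpow_mul]
          congr 2
          rw [hq]
          push_cast
          field_simp
  -- Write `q / (2n)` as `(q - 1) / (2n) + 1 / (2n)`. The first power absorbs `r ^ (q - 1)` through
  -- Chebyshev; the second is left for Hölder in `r`.
  have hpt : ∀ r : ℝ, 0 < r → volume {p | r < ‖f p‖} * ENNReal.ofReal (r ^ (q - 1)) ≤
      c * (∏ i, T i) ^ ((q - 1) / (2 * n)) * ∏ i, v i r ^ (1 / (2 * n) : ℝ) := by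
    intro r hr
    have e1 : ENNReal.ofReal (r ^ (q - 1)) =
        (∏ _i : Fin n ⊕ Fin n, ENNReal.ofReal r) ^ ((q - 1) / (2 * n)) := by
      rw [← ENNReal.ofReal_rpow_of_pos hr, Finset.prod_const, ← ENNReal.rpow_natCast,
        ← ENNReal.rpow_mul]
      congr 1
      simp
      field_simp
      ring
    have hq2 : 0 ≤ (q - 1) / (2 * n) := div_nonneg (by linarith) (by positivity)
    calc _ ≤ c * (∏ i, v i r) ^ (q / (2 * n)) * ENNReal.ofReal (r ^ (q - 1)) := by
          gcongr
          exact hvol r hr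
      _ = c * (∏ i, ENNReal.ofReal r * v i r) ^ ((q - 1) / (2 * n)) *
            (∏ i, v i r) ^ (1 / (2 * n) : ℝ) := by
          rw [Finset.prod_mul_distrib, ENNReal.mul_rpow_of_nonneg _ _ hq2, ← e1,
            show q / (2 * n) = (q - 1) / (2 * n) + 1 / (2 * n) by ring,
            ENNReal.rpow_add_of_nonneg _ _ hq2 (by positivity)]
          ring
      _ ≤ _ := by
          rw [ENNReal.prod_rpow_of_nonneg (by positivity)]
          gcongr
          exact hvT _ r
  -- Hölder with `2n` factors of weight `1 / (2n)`; each `v i` integrates to at most `T i` by the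
  -- layer cake formula.
  have hholder : ∫⁻ r in Ioi (0 : ℝ), ∏ i, v i r ^ (1 / (2 * n) : ℝ) ≤
      (∏ i, T i) ^ (1 / (2 * n) : ℝ) := by
    refine (ENNReal.lintegral_prod_norm_pow_le Finset.univ (fun i _ => (hvm i).aemeasurable)
      ?_ (fun _ _ => by positivity)).trans ?_
    · simp
      field_simp
      norm_num
    · rw [ENNReal.prod_rpow_of_nonneg (by positivity)]
      gcongr
      exact hvint _
  have hlayer := lintegral_rpow_eq_lintegral_meas_lt_mul volume (f := fun p => ‖f p‖)
    (Eventually.of_forall fun p => norm_nonneg _) hf.norm.aemeasurable hq0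
  have e0 : ∀ p, ‖f p‖ₑ ^ q = ENNReal.ofReal (‖f p‖ ^ q) := fun p => by
    rw [← ofReal_norm, ENNReal.ofReal_rpow_of_nonneg (norm_nonneg _) hq0.le]
  simp only [e0]
  rw [hlayer]
  gcongr
  calc _ ≤ ∫⁻ r in Ioi (0 : ℝ),
        c * (∏ i, T i) ^ ((q - 1) / (2 * n)) * ∏ i, v i r ^ (1 / (2 * n) : ℝ) :=
        setLIntegral_mono' measurableSet_Ioi fun r hr => hpt r hr
    _ = c * (∏ i, T i) ^ ((q - 1) / (2 * n)) *
          ∫⁻ r in Ioi (0 : ℝ), ∏ i, v i r ^ (1 / (2 * n) : ℝ) :=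
        lintegral_const_mul _ (Finset.measurable_prod _ fun i _ => (hvm i).pow_const _)
    _ ≤ c * (∏ i, T i) ^ ((q - 1) / (2 * n)) * (∏ i, T i) ^ (1 / (2 * n) : ℝ) := by gcongr
    _ = _ := by
        rw [mul_assoc, ← ENNReal.rpow_add_of_nonneg _ _
          (div_nonneg (by linarith) (by positivity)) (by positivity), ← add_div,
          sub_add_cancel]

end Heis

/-! ### The Sobolev inequality -/

theorem theorem1p3 (n : ℕ) (hn : 1 ≤ n) :
    ∃ C : ℝ, 0 < C ∧
      ∀ f : Heis n → ℝ, Heis.MemBV f →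
        ∀ μ : Fin n ⊕ Fin n → SignedMeasure (Heis n), (∀ j, Heis.IsDistribDeriv j f (μ j)) →
          eLpNorm f ((2 * n + 2) / (2 * n + 1)) volume ≤
            ENNReal.ofReal C *
              ∏ j : Fin n ⊕ Fin n, ((μ j).totalVariation Set.univ) ^ (1 / (2 * n) : ℝ) := by
  have hn0 : (0 : ℝ) < n := by exact_mod_cast hn
  obtain ⟨q, hq⟩ : ∃ q : ℝ, q = (2 * n + 2) / (2 * n + 1) := ⟨_, rfl⟩
  have hq0 : 0 < q := by rw [hq]; positivity
  set c : ℝ≥0∞ := ENNReal.ofReal q *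
    ((2 * n + 2) ^ (2 * n * (n + 1)) * 8 ^ n) ^ (1 / (n * (2 * n + 1)) : ℝ) with hc
  have hct : c ≠ ⊤ := ENNReal.mul_ne_top ENNReal.ofReal_ne_top
    (ENNReal.rpow_ne_top_of_nonneg (by positivity) (by finiteness))
  have hc0 : c ≠ 0 := by
    refine mul_ne_zero (by simpa using hq0) ?_
    rw [Ne, ENNReal.rpow_eq_zero_iff]
    rintro (⟨h, -⟩ | ⟨-, h⟩)
    · simp at h
    · exact absurd h (not_lt.2 (by positivity))
  have hCt : c ^ (1 / q) ≠ ⊤ := ENNReal.rpow_ne_top_of_nonneg (by positivity) hct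
  refine ⟨(c ^ (1 / q)).toReal, ENNReal.toReal_pos ?_ hCt, fun f hf μ hμ => ?_⟩
  · rw [Ne, ENNReal.rpow_eq_zero_iff]
    rintro (⟨h, -⟩ | ⟨h, -⟩)
    exacts [hc0 h, hct h]
  -- A Borel representative has the same distributional derivatives and the same norm.
  obtain ⟨g, hg, hfg⟩ := hf.1.aemeasurable
  have hgi : Integrable g := hf.1.congr hfg
  have hμg : ∀ j, Heis.IsDistribDeriv j g (μ j) := fun j φ hφ hφ' => by
    rw [← hμ j φ hφ hφ']
    refine integral_congr_ae ?_
    filter_upwards [hfg] with p hp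
    rw [hp]
  choose W hWm hWi hgW hWT using fun j => (hμg j).exists_invariant_bound hgi hg
  have key := Heis.lintegral_enorm_rpow_le hn hg hgi hWm hWi hgW
    (fun j => measure_ne_top _ _) hWT hq
  have hp : ((2 * n + 2) / (2 * n + 1) : ℝ≥0∞) = ENNReal.ofReal q := by
    rw [hq, ENNReal.ofReal_div_of_pos (by positivity)]
    congr 1 <;> exact_mod_cast (ENNReal.ofReal_natCast _).symm
  rw [eLpNorm_congr_ae hfg, hp, eLpNorm_eq_lintegral_rpow_enorm_toReal (by simpa using hq0)
    ENNReal.ofReal_ne_top, ENNReal.toReal_ofReal hq0.le, ENNReal.ofReal_toReal hCt,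
    ENNReal.prod_rpow_of_nonneg (by positivity)]
  refine (ENNReal.rpow_le_rpow key (by positivity)).trans_eq ?_
  rw [← mul_assoc, ← hc, ENNReal.mul_rpow_of_nonneg _ _ (by positivity), ← ENNReal.rpow_mul]
  congr 2
  field_simp
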